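/- For a metric space $X$ and an integer $n\ge 0$, $\operatorname{asdim}X\le n$ means that for every $d>0$ there are $n+1$ uniformly bounded families $\mathcal U^0,\dots,\mathcal U^n$ of subsets of $X$, together covering $X$, such that in each family any two distinct members are $d$-disjoint (every point of the one has distance at least $d$ from every point of the other). A finitely generated group $\Gamma$ and its subsets carry the word metric $d_S(x,y)=\|x^{-1}y\|_S$, where $S=S^{-1}$ is a finite generating set and $\|g\|_S$ is the minimal length of a word in $S$ representing $g$. By a tree we mean a geodesic metric space in which any two distinct points are joined by a unique arc (up to parametrization); for instance the geometric realization of a simplicial tree with its length metric. Let $\Gamma$ be a finitely generated group acting by isometries on a tree $X$ with base point $x_0\in X$, and for $R>0$ let $$W_R(x_0)=\{g\in\Gamma : d_X(g x_0,x_0)\le R\}$$ be the $R$-stabilizer of $x_0$. Let $k\ge 0$ be an integer, and suppose that, for the word metric of some finite symmetric generating set of $\Gamma$, $\operatorname{asdim}W_R(x_0)\le k$ for all $R>0$. Then $\operatorname{asdim}\Gamma\le k+1$ with respect to the word metric of every finite symmetric generating set of $\Gamma$. -/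

import Mathlib

/-- `asdim X ≤ n`: for every `d > 0` there are `n + 1` families of subsets of `X`, uniformly
bounded, each of them consisting of pairwise `d`-disjoint sets, which together cover `X`.
Two sets are `d`-disjoint if every point of one is at distance at least `d` from every point of
the other. -/
def AsdimLE (X : Type*) [MetricSpace X] (n : ℕ) : Prop :=
  ∀ d : ℝ, 0 < d → ∃ U : Fin (n + 1) → Set (Set X),
    (∃ D : ℝ, ∀ i, ∀ u ∈ U i, ∀ x ∈ u, ∀ y ∈ u, dist x y ≤ D) ∧
    (∀ i, ∀ u ∈ U i, ∀ v ∈ U i, u ≠ v → ∀ x ∈ u, ∀ y ∈ v, d ≤ dist x y) ∧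
    (∀ x : X, ∃ i, ∃ u ∈ U i, x ∈ u)

/-- A metric tree: a geodesic metric space in which any two points are joined by at most one arc
(an arc is an injective path, and two arcs are identified if they have the same image).
The geometric realization of a simplicial tree, with its length metric, is such a space. -/
structure IsMetricTree (X : Type*) [MetricSpace X] : Prop where
  /-- any two points are joined by a geodesic segment -/
  geodesic : ∀ x y : X, ∃ γ : ℝ → X, γ 0 = x ∧ γ (dist x y) = y ∧
    ∀ s ∈ Set.Icc 0 (dist x y), ∀ t ∈ Set.Icc 0 (dist x y), dist (γ s) (γ t) = |s - t|
  /-- arcs with the same endpoints coincide -/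
  unique_arc : ∀ (x y : X) (α β : Path x y), Function.Injective α → Function.Injective β →
    Set.range α = Set.range β

/-- `S` is a finite symmetric generating set of `Γ`. -/
structure IsFiniteGeneratingSet {Γ : Type*} [Group Γ] (S : Set Γ) : Prop where
  finite : S.Finite
  inv_mem : ∀ s ∈ S, s⁻¹ ∈ S
  closure_eq_top : Subgroup.closure S = ⊤

/-- The norm `‖g‖_S`: the minimal length of a word in the alphabet `S` which represents `g`. -/
noncomputable def wordNorm {Γ : Type*} [Group Γ] (S : Set Γ) (g : Γ) : ℕ :=
  sInf {n : ℕ | ∃ l : List Γ, (∀ s ∈ l, s ∈ S) ∧ l.prod = g ∧ l.length = n}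

theorem IsFiniteGeneratingSet.exists_word {Γ : Type*} [Group Γ] {S : Set Γ}
    (hS : IsFiniteGeneratingSet S) (g : Γ) :
    ∃ l : List Γ, (∀ s ∈ l, s ∈ S) ∧ l.prod = g ∧ l.length = wordNorm S g := by
  have hne : {n : ℕ | ∃ l : List Γ, (∀ s ∈ l, s ∈ S) ∧ l.prod = g ∧ l.length = n}.Nonempty := by
    have hg : g ∈ (Subgroup.closure S).toSubmonoid := by rw [hS.closure_eq_top]; trivial
    rw [Subgroup.closure_toSubmonoid] at hg
    obtain ⟨l, hl, hp⟩ := Submonoid.exists_list_of_mem_closure hg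
    refine ⟨l.length, l, fun s hs => ?_, hp, rfl⟩
    rcases hl s hs with h | h
    · exact h
    · simpa using hS.inv_mem _ h
  exact Nat.sInf_mem hne

theorem wordNorm_prod_le {Γ : Type*} [Group Γ] {S : Set Γ} (l : List Γ) (hl : ∀ s ∈ l, s ∈ S) :
    wordNorm S l.prod ≤ l.length :=
  Nat.sInf_le ⟨l, hl, rfl, rfl⟩

theorem IsFiniteGeneratingSet.wordNorm_mul_le {Γ : Type*} [Group Γ] {S : Set Γ}
    (hS : IsFiniteGeneratingSet S) (a b : Γ) :
    wordNorm S (a * b) ≤ wordNorm S a + wordNorm S b := by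
  obtain ⟨l, hl, hp, hn⟩ := hS.exists_word a
  obtain ⟨l', hl', hp', hn'⟩ := hS.exists_word b
  rw [← hn, ← hn', ← List.length_append, ← hp, ← hp', ← List.prod_append]
  refine wordNorm_prod_le _ fun s hs => ?_
  rcases List.mem_append.1 hs with h | h
  · exact hl s h
  · exact hl' s h

theorem IsFiniteGeneratingSet.wordNorm_inv_le {Γ : Type*} [Group Γ] {S : Set Γ}
    (hS : IsFiniteGeneratingSet S) (a : Γ) : wordNorm S a⁻¹ ≤ wordNorm S a := by
  obtain ⟨l, hl, hp, hn⟩ := hS.exists_word a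
  rw [← hn, ← hp, List.prod_inv_reverse]
  refine (wordNorm_prod_le _ fun s hs => ?_).trans (by simp)
  rw [List.mem_reverse, List.mem_map] at hs
  obtain ⟨t, ht, rfl⟩ := hs
  exact hS.inv_mem _ (hl t ht)

/-- The group `Γ` with the word metric `d_S(x, y) = ‖x⁻¹ y‖_S`. -/
@[reducible] noncomputable def wordMetric {Γ : Type*} [Group Γ] (S : Set Γ)
    (hS : IsFiniteGeneratingSet S) : MetricSpace Γ where
  dist x y := (wordNorm S (x⁻¹ * y) : ℝ)
  dist_self x := by
    have h := wordNorm_prod_le (S := S) [] (by simp)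
    have h0 : wordNorm S (1 : Γ) = 0 := by simpa using h
    simp [h0]
  dist_comm x y := by
    have h1 := hS.wordNorm_inv_le (x⁻¹ * y)
    have h2 := hS.wordNorm_inv_le (y⁻¹ * x)
    rw [mul_inv_rev, inv_inv] at h1 h2
    exact_mod_cast le_antisymm h2 h1
  dist_triangle x y z := by
    have h := hS.wordNorm_mul_le (x⁻¹ * y) (y⁻¹ * z)
    rw [mul_assoc, mul_inv_cancel_left] at h
    exact_mod_cast h
  eq_of_dist_eq_zero := by
    intro x y h
    have h0 : wordNorm S (x⁻¹ * y) = 0 := by exact_mod_cast h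
    obtain ⟨l, -, hp, hn⟩ := hS.exists_word (x⁻¹ * y)
    rw [h0, List.length_eq_zero_iff] at hn
    subst hn
    exact (inv_mul_eq_one.1 hp.symm)

/-- The `R`-stabilizer `W_R(x₀)`: all `g ∈ Γ` which move `x₀` into the closed ball of radius `R`
around `x₀`. -/
def rStabilizer (Γ : Type*) [Group Γ] {X : Type*} [MetricSpace X] [MulAction Γ X]
    (x₀ : X) (R : ℝ) : Set Γ :=
  {g : Γ | g • x₀ ∈ Metric.closedBall x₀ R}

/-!
The orbit map `g ↦ g • x₀` is Lipschitz for the word metric, and the preimage of the ball of radius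
`R` around `g • x₀` is the translate `g W_R(x₀)`, which is isometric to `W_R(x₀)`. The theorem is
therefore a case of a Hurewicz type statement for Lipschitz maps `f : Z → X` to trees
(`asdimLE_succ_of_map_to_tree`); independence of the generating set is the bi-Lipschitz equivalence
of word metrics.

Root the tree at `o`. By uniqueness of arcs two points of height at least `l` have distance at most
`|x| + |y| - 2 l` if their ancestors at height `l` agree, and at least that much if they differ
(`IsMetricTree.exists_ancestor`). Hence blocks of heights `n L ≤ |x| < (n + 1) L` fall into bounded
cells, given by the ancestor at height `(n - 1) L`, and distinct cells of one block are far apart.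

Fix a scale `d`. Cut every block into a lower and an upper half. Distinct cells of lower halves
are far apart, so that the preimage of all lower halves is covered by `k + 1` sets, the colours,
each of which is a `d`-disjoint union of `R`-bounded clusters. The preimages of the upper halves are covered, cell by
cell, by `k + 1` such sets at a scale which is large compared with `R`. A colour of the lower halves
can be merged with the same colour of a neighbouring upper half by saturation
(`IsClustered.union`), but merging with the upper halves on both sides would create unbounded chains
of clusters. So colour `i` is cut inside each lower half along a thin collar at relative height
`t i`; between consecutive collars there is only one upper half, and merging is harmless. The
collars of different colours are disjoint and far apart, so one additional colour can cover all that
the `k + 1` colours lose in their collars. This makes `k + 2` colours.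
-/

open Set

/-! ### Branching in metric trees -/

/-- `γ` restricted to `[0, a]` is a geodesic segment parametrized by arc length. -/
def IsGeodesicOn {X : Type*} [MetricSpace X] (γ : ℝ → X) (a : ℝ) : Prop :=
  ∀ s ∈ Icc 0 a, ∀ t ∈ Icc 0 a, dist (γ s) (γ t) = |s - t|

namespace IsGeodesicOn

variable {X : Type*} [MetricSpace X] {γ : ℝ → X} {a : ℝ}

theorem mono {b : ℝ} (h : IsGeodesicOn γ a) (hb : b ≤ a) : IsGeodesicOn γ b :=
  fun s hs t ht => h s ⟨hs.1, hs.2.trans hb⟩ t ⟨ht.1, ht.2.trans hb⟩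

theorem isometry_domRestrict (h : IsGeodesicOn γ a) : Isometry ((Icc 0 a).domRestrict γ) :=
  Isometry.of_dist_eq fun s t => h s s.2 t t.2

theorem continuousOn (h : IsGeodesicOn γ a) : ContinuousOn γ (Icc 0 a) :=
  continuousOn_iff_continuous_domRestrict.2 h.isometry_domRestrict.continuous

theorem injOn (h : IsGeodesicOn γ a) : InjOn γ (Icc 0 a) :=
  injOn_iff_injective.2 h.isometry_domRestrict.injective

theorem dist_zero (h : IsGeodesicOn γ a) {t : ℝ} (ht : t ∈ Icc 0 a) : dist (γ 0) (γ t) = t := by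
  rw [h 0 ⟨le_rfl, ht.1.trans ht.2⟩ t ht, zero_sub, abs_neg, abs_of_nonneg ht.1]

theorem dist_end (h : IsGeodesicOn γ a) {t : ℝ} (ht : t ∈ Icc 0 a) : dist (γ t) (γ a) = a - t := by
  rw [h t ht a ⟨ht.1.trans ht.2, le_rfl⟩, abs_sub_comm, abs_of_nonneg (sub_nonneg.2 ht.2)]

end IsGeodesicOn

namespace IsMetricTree

variable {X : Type*} [MetricSpace X]

/-- Uniqueness of arcs, for arcs parametrized by arbitrary compact intervals. -/
theorem image_Icc_eq (hX : IsMetricTree X) {a b a' b' : ℝ} (hab : a < b) (hab' : a' < b')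
    {c c' : ℝ → X} (hc : ContinuousOn c (Icc a b)) (hc' : ContinuousOn c' (Icc a' b'))
    (hi : InjOn c (Icc a b)) (hi' : InjOn c' (Icc a' b'))
    (h0 : c a = c' a') (h1 : c b = c' b') : c '' Icc a b = c' '' Icc a' b' := by
  have key : ∀ {a b : ℝ} {c : ℝ → X} {x y : X}, a < b → ContinuousOn c (Icc a b) →
      InjOn c (Icc a b) → c a = x → c b = y →
      ∃ p : Path x y, Function.Injective p ∧ range p = c '' Icc a b := by
    intro a b c x y hab hc hi hx hy
    refine ⟨{ toFun := (Icc a b).domRestrict c ∘ (iccHomeoI a b hab).symm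
              continuous_toFun := (continuousOn_iff_continuous_domRestrict.1 hc).comp
                (iccHomeoI a b hab).symm.continuous
              source' := by simp [hx]
              target' := by simp [hy] }, ?_, ?_⟩
    · exact (injOn_iff_injective.1 hi).comp (iccHomeoI a b hab).symm.injective
    · change range ((Icc a b).domRestrict c ∘ (iccHomeoI a b hab).symm) = _
      rw [(iccHomeoI a b hab).symm.surjective.range_comp, range_domRestrict]
  obtain ⟨p, hp, hpr⟩ := key hab hc hi h0 h1
  obtain ⟨q, hq, hqr⟩ := key hab' hc' hi' rfl rfl
  rw [← hpr, ← hqr, hX.unique_arc _ _ p q hp hq]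

/-- Two geodesics issuing from the same point which agree at a time `t` agree up to `t`. -/
theorem geodesic_eq_of_le (hX : IsMetricTree X) {α β : ℝ → X} {t u : ℝ}
    (hα : IsGeodesicOn α t) (hβ : IsGeodesicOn β t) (h0 : α 0 = β 0) (ht : α t = β t)
    (hu : u ∈ Icc 0 t) : α u = β u := by
  rcases (hu.1.trans hu.2).eq_or_lt with h | h
  · obtain rfl : u = 0 := le_antisymm (hu.2.trans h.ge) hu.1
    exact h0
  · have him := hX.image_Icc_eq h h hα.continuousOn hβ.continuousOn hα.injOn hβ.injOn h0 ht
    obtain ⟨v, hv, hvu⟩ : α u ∈ β '' Icc 0 t := him ▸ mem_image_of_mem α hu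
    have h1 := hβ.dist_zero hv
    rw [hvu, ← h0, hα.dist_zero hu] at h1
    rw [← hvu, h1]

/-- If two geodesics issuing from the same point have parted at time `l`, then the geodesic between
their endpoints runs through their branch point, so it is long. -/
theorem le_dist_of_ne (hX : IsMetricTree X) {α β : ℝ → X} {a b l : ℝ}
    (hα : IsGeodesicOn α a) (hβ : IsGeodesicOn β b) (h0 : α 0 = β 0) (hl : 0 ≤ l)
    (hla : l ≤ a) (hlb : l ≤ b) (hne : α l ≠ β l) : a + b - 2 * l ≤ dist (α a) (β b) := by
  -- the branch point is `α s`, where `s` is the last time at which `α` and `β` agree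
  obtain ⟨s, ⟨hs, hsαβ⟩, hmax⟩ : ∃ s, IsGreatest {t ∈ Icc 0 (min a b) | α t = β t} s := by
    have hαc := hα.continuousOn.mono (Icc_subset_Icc_right (min_le_left a b))
    have hβc := hβ.continuousOn.mono (Icc_subset_Icc_right (min_le_right a b))
    have hclosed : IsClosed {t ∈ Icc 0 (min a b) | α t = β t} := by
      convert (continuous_dist.comp_continuousOn (hαc.prodMk hβc)).preimage_isClosed_of_isClosed
        isClosed_Icc (isClosed_singleton (x := 0)) using 1
      ext t
      simp [dist_eq_zero]
    exact (isCompact_Icc.of_isClosed_subset hclosed fun t ht => ht.1).exists_isGreatest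
      ⟨0, ⟨le_rfl, hl.trans (le_min hla hlb)⟩, h0⟩
  have hsa : s ≤ a := hs.2.trans (min_le_left _ _)
  have hsb : s ≤ b := hs.2.trans (min_le_right _ _)
  have hsl : s < l := by
    by_contra! h
    exact hne (hX.geodesic_eq_of_le (hα.mono hsa) (hβ.mono hsb) h0 hsαβ ⟨hl, h⟩)
  -- the concatenation of `α` backwards from `α a` to the branch point, and of `β` from there on
  set c : ℝ → X := fun u => if u ≤ 0 then α (s - u) else β (s + u) with hc
  have hcα : ∀ u ≤ 0, c u = α (s - u) := fun u hu => if_pos hu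
  have hcβ : ∀ u, 0 ≤ u → c u = β (s + u) := by
    intro u hu
    rcases hu.eq_or_lt with rfl | hu
    · simp [hc, hsαβ]
    · exact if_neg hu.not_ge
  have hleft : c (-(a - s)) = α a := by rw [hcα _ (by linarith)]; congr 1; ring
  have hright : c (b - s) = β b := by rw [hcβ _ (by linarith)]; congr 1; ring
  have hcont : ContinuousOn c (Icc (-(a - s)) (b - s)) := by
    rw [← Icc_union_Icc_eq_Icc (b := 0) (by linarith) (by linarith)]
    refine ContinuousOn.union_of_isClosed ?_ ?_ isClosed_Icc isClosed_Icc
    · refine ContinuousOn.congr (hα.continuousOn.comp (f := fun u => s - u) (by fun_prop) ?_)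
        fun u hu => hcα u hu.2
      intro u hu
      constructor <;> linarith [hu.1, hu.2, hs.1]
    · refine ContinuousOn.congr (hβ.continuousOn.comp (f := fun u => s + u) (by fun_prop) ?_)
        fun u hu => hcβ u hu.1
      intro u hu
      constructor <;> linarith [hu.1, hu.2, hs.1]
  have hdisj : ∀ u ∈ Icc (-(a - s)) (b - s), ∀ v ∈ Icc (-(a - s)) (b - s), u ≤ 0 → 0 < v →
      c u ≠ c v := by
    intro u hu v hv hu0 hv0 huv
    rw [hcα u hu0, hcβ v hv0.le] at huv
    have h1 := hα.dist_zero (t := s - u) ⟨by linarith [hs.1], by linarith [hu.1]⟩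
    have h2 := hβ.dist_zero (t := s + v) ⟨by linarith [hs.1], by linarith [hv.2]⟩
    rw [huv, h0, h2] at h1
    rw [← h1] at huv
    have := hmax ⟨⟨by linarith [hs.1], le_min (by linarith [hu.1]) (by linarith [hv.2])⟩, huv⟩
    linarith
  have hinj : InjOn c (Icc (-(a - s)) (b - s)) := by
    intro u hu v hv huv
    rcases le_or_gt u 0 with hu0 | hu0 <;> rcases le_or_gt v 0 with hv0 | hv0
    · rw [hcα u hu0, hcα v hv0] at huv
      have := hα.injOn ⟨by linarith [hs.1], by linarith [hu.1]⟩
        ⟨by linarith [hs.1], by linarith [hv.1]⟩ huv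
      linarith
    · exact absurd huv (hdisj u hu v hv hu0 hv0)
    · exact absurd huv.symm (hdisj v hv u hu hv0 hu0)
    · rw [hcβ u hu0.le, hcβ v hv0.le] at huv
      have := hβ.injOn ⟨by linarith [hs.1], by linarith [hu.2]⟩
        ⟨by linarith [hs.1], by linarith [hv.2]⟩ huv
      linarith
  obtain ⟨γ, hγ0, hγ1, hγ⟩ := hX.geodesic (α a) (β b)
  replace hγ : IsGeodesicOn γ (dist (α a) (β b)) := hγ
  have hpos : 0 < dist (α a) (β b) := by
    refine dist_pos.2 fun h => ?_
    rw [← hleft, ← hright] at h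
    have := hinj ⟨le_rfl, by linarith⟩ ⟨by linarith, le_rfl⟩ h
    linarith
  have him := hX.image_Icc_eq (by linarith) hpos hcont hγ.continuousOn hinj hγ.injOn
    (hleft.trans hγ0.symm) (hright.trans hγ1.symm)
  obtain ⟨w, hw, hws⟩ : α s ∈ γ '' Icc 0 (dist (α a) (β b)) := by
    rw [← him]
    exact ⟨0, ⟨by linarith, by linarith⟩, by simp [hc]⟩
  have h1 := hγ.dist_zero hw
  have h2 := hγ.dist_end hw
  rw [hws, hγ0, dist_comm, hα.dist_end ⟨hs.1, hsa⟩] at h1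
  rw [hws, hγ1, hsαβ, hβ.dist_end ⟨hs.1, hsb⟩] at h2
  linarith

/-- `anc l x` is the ancestor of `x` at height `l` in the tree rooted at `o`: the point at distance
`l` from `o` on the geodesic from `o` to `x` (the root itself if `l ≤ 0`). Points with the same
ancestor are close to each other, points with different ancestors are far apart. -/
theorem exists_ancestor (hX : IsMetricTree X) (o : X) : ∃ anc : ℝ → X → X,
    ∀ l x y, l ≤ dist o x → l ≤ dist o y →
      (anc l x = anc l y → dist x y ≤ dist o x + dist o y - 2 * l) ∧
      (anc l x ≠ anc l y → dist o x + dist o y - 2 * l ≤ dist x y) := by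
  choose γ h0 h1 hγ using hX.geodesic o
  replace hγ : ∀ x, IsGeodesicOn (γ x) (dist o x) := hγ
  refine ⟨fun l x => γ x (max l 0), fun l x y hx hy => ?_⟩
  have hx' : max l 0 ∈ Icc 0 (dist o x) := ⟨le_max_right _ _, max_le hx dist_nonneg⟩
  have hy' : max l 0 ∈ Icc 0 (dist o y) := ⟨le_max_right _ _, max_le hy dist_nonneg⟩
  constructor
  · intro h
    have e1 := (hγ x).dist_end hx'
    have e2 := (hγ y).dist_end hy'
    rw [h1] at e1 e2
    have := dist_triangle_left x y (γ x (max l 0))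
    rw [e1, show γ x (max l 0) = γ y (max l 0) from h, e2] at this
    linarith [le_max_left l 0]
  · intro h
    rcases le_or_gt l 0 with hl | hl
    · simp only [max_eq_right hl, h0, ne_eq, not_true_eq_false] at h
    · have := hX.le_dist_of_ne (hγ x) (hγ y) ((h0 x).trans (h0 y).symm) hx'.1 hx'.2 hy'.2 h
      rwa [h1, h1, max_eq_left hl.le] at this

end IsMetricTree

/-! ### Clustered sets -/

/-- `A` splits into uniformly `D`-bounded clusters which are pairwise `d`-disjoint; the clusters are
the traces on `A` of the classes of an equivalence relation. -/
def IsClustered {Z : Type*} [MetricSpace Z] (A : Set Z) (d D : ℝ) : Prop :=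
  ∃ r : Setoid Z, (∀ x ∈ A, ∀ y ∈ A, dist x y < d → r x y) ∧
    ∀ x ∈ A, ∀ y ∈ A, r x y → dist x y ≤ D

namespace IsClustered

variable {Z : Type*} [MetricSpace Z] {A B : Set Z} {d D : ℝ}

theorem of_label {ι : Type*} (c : Z → ι)
    (h₁ : ∀ x ∈ A, ∀ y ∈ A, dist x y < d → c x = c y)
    (h₂ : ∀ x ∈ A, ∀ y ∈ A, c x = c y → dist x y ≤ D) : IsClustered A d D :=
  ⟨Setoid.ker c, h₁, h₂⟩

theorem mono (h : IsClustered B d D) (hAB : A ⊆ B) : IsClustered A d D := by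
  obtain ⟨r, h₁, h₂⟩ := h
  exact ⟨r, fun x hx y hy => h₁ x (hAB hx) y (hAB hy), fun x hx y hy => h₂ x (hAB hx) y (hAB hy)⟩

theorem mono_right {D' : ℝ} (h : IsClustered A d D) (hD : D ≤ D') : IsClustered A d D' := by
  obtain ⟨r, h₁, h₂⟩ := h
  exact ⟨r, h₁, fun x hx y hy hxy => (h₂ x hx y hy hxy).trans hD⟩

theorem empty : IsClustered (∅ : Set Z) d D :=
  ⟨⊤, by simp, by simp⟩

/-- A union of uniformly clustered sets which are pairwise `d`-disjoint is clustered. -/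
theorem iUnion {ι : Type*} {A : ι → Set Z} (hd : 0 < d) (hA : ∀ i, IsClustered (A i) d D)
    (hsep : ∀ i j, ∀ x ∈ A i, ∀ y ∈ A j, dist x y < d → i = j) :
    IsClustered (⋃ i, A i) d D := by
  classical
  choose r h₁ h₂ using hA
  rcases isEmpty_or_nonempty ι with hι | hι
  · rw [iUnion_of_empty]
    exact empty
  have huniq : ∀ x : Z, ∃ j, ∀ i, x ∈ A i → i = j := by
    intro x
    by_cases hx : ∃ j, x ∈ A j
    · obtain ⟨j, hj⟩ := hx
      exact ⟨j, fun i hi => hsep i j x hi x hj (by simpa using hd)⟩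
    · push Not at hx
      exact ⟨Classical.arbitrary ι, fun i hi => absurd hi (hx i)⟩
  choose p hp using huniq
  refine of_label (fun x => (⟨p x, Quotient.mk (r (p x)) x⟩ : Σ i, Quotient (r i))) ?_ ?_
  · intro x hx y hy hxy
    obtain ⟨i, hi⟩ := mem_iUnion.1 hx
    obtain ⟨j, hj⟩ := mem_iUnion.1 hy
    obtain rfl := hsep i j x hi y hj hxy
    rw [← hp x i hi, ← hp y i hj]
    congr 1
    exact Quotient.sound (h₁ i x hi y hj hxy)
  · intro x hx y hy hxy
    obtain ⟨i, hi⟩ := mem_iUnion.1 hx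
    obtain ⟨j, hj⟩ := mem_iUnion.1 hy
    rw [← hp x i hi, ← hp y j hj] at hxy
    obtain rfl : i = j := (Sigma.mk.inj hxy).1
    exact h₂ i x hi y hj (Quotient.exact (eq_of_heq (Sigma.mk.inj hxy).2))

/-- Saturated union: if the clusters of `B` are far apart in comparison with the size of those of
`A`, then adding to each cluster of `B` the clusters of `A` next to it gives clusters of `A ∪ B`. -/
theorem union {R : ℝ} (hA : IsClustered A d R) (hB : IsClustered B (2 * R + 3 * d) D) (hd : 0 < d)
    (hR : 0 ≤ R) (hD : 0 ≤ D) : IsClustered (A ∪ B) d (D + 2 * (R + d)) := by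
  classical
  obtain ⟨r, h₁, h₂⟩ := hA
  obtain ⟨q, k₁, k₂⟩ := hB
  -- the points of `B` to which a point gets attached
  set N : Z → Set Z := fun x =>
    {b ∈ B | b = x ∨ x ∈ A ∧ ∃ a ∈ A, r a x ∧ dist a b < d} with hN
  have hdist : ∀ x, ∀ b ∈ N x, dist x b < R + d := by
    rintro x b ⟨-, rfl | ⟨hx, a, ha, hax, hab⟩⟩
    · rw [dist_self]; linarith
    · linarith [dist_triangle_left x b a, h₂ a ha x hx hax]
  have hne : ∀ x ∈ A ∪ B, ∀ y ∈ A ∪ B, dist x y < d → (N x).Nonempty → (N y).Nonempty := by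
    rintro x hx y hy hxy ⟨b, hb, hbx⟩
    by_cases hyB : y ∈ B
    · exact ⟨y, hyB, Or.inl rfl⟩
    have hyA : y ∈ A := hy.resolve_right hyB
    by_cases hxB : x ∈ B
    · exact ⟨x, hxB, Or.inr ⟨hyA, y, hyA, r.refl y, by rwa [dist_comm]⟩⟩
    · rcases hbx with rfl | ⟨hxA, a, ha, hax, hab⟩
      · exact absurd hb hxB
      · exact ⟨b, hb, Or.inr ⟨hyA, a, ha, r.trans hax (h₁ x hxA y hyA hxy), hab⟩⟩
  refine of_label (fun x => if h : (N x).Nonempty then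
      (Sum.inl (Quotient.mk q h.some) : Quotient q ⊕ Quotient r) else Sum.inr (Quotient.mk r x)) ?_ ?_
  · intro x hx y hy hxy
    by_cases hNx : (N x).Nonempty
    · have hNy := hne x hx y hy hxy hNx
      simp only [dif_pos hNx, dif_pos hNy]
      congr 1
      refine Quotient.sound (k₁ _ hNx.some_mem.1 _ hNy.some_mem.1 ?_)
      have e₁ := hdist x _ hNx.some_mem
      have e₂ := hdist y _ hNy.some_mem
      have e₃ := dist_triangle4 hNx.some x y hNy.some
      rw [dist_comm hNx.some x] at e₃
      linarith
    · have hNy : ¬ (N y).Nonempty := fun h => hNx (hne y hy x hx (by rwa [dist_comm]) h)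
      simp only [dif_neg hNx, dif_neg hNy]
      have hmem : ∀ z ∈ A ∪ B, ¬ (N z).Nonempty → z ∈ A := fun z hz h =>
        hz.resolve_right fun hzB => h ⟨z, hzB, Or.inl rfl⟩
      congr 1
      exact Quotient.sound (h₁ x (hmem x hx hNx) y (hmem y hy hNy) hxy)
  · intro x hx y hy hxy
    by_cases hNx : (N x).Nonempty <;> by_cases hNy : (N y).Nonempty
    · simp only [dif_pos hNx, dif_pos hNy] at hxy
      have e := k₂ _ hNx.some_mem.1 _ hNy.some_mem.1 (Quotient.exact (Sum.inl.inj hxy))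
      have e₁ := hdist x _ hNx.some_mem
      have e₂ := hdist y _ hNy.some_mem
      have e₃ := dist_triangle4 x hNx.some hNy.some y
      rw [dist_comm hNy.some y] at e₃
      linarith
    · simp [hNx, hNy] at hxy
    · simp [hNx, hNy] at hxy
    · simp only [dif_neg hNx, dif_neg hNy] at hxy
      have hmem : ∀ z ∈ A ∪ B, ¬ (N z).Nonempty → z ∈ A := fun z hz h =>
        hz.resolve_right fun hzB => h ⟨z, hzB, Or.inl rfl⟩
      have := h₂ x (hmem x hx hNx) y (hmem y hy hNy) (Quotient.exact (Sum.inr.inj hxy))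
      linarith

/-- The union of a `d`-disjoint uniformly bounded family of sets is clustered. -/
theorem sUnion {U : Set (Set Z)} (hd : 0 < d)
    (hD : ∀ u ∈ U, ∀ x ∈ u, ∀ y ∈ u, dist x y ≤ D)
    (hsep : ∀ u ∈ U, ∀ v ∈ U, u ≠ v → ∀ x ∈ u, ∀ y ∈ v, d ≤ dist x y) :
    IsClustered (⋃₀ U) d D := by
  rw [sUnion_eq_iUnion]
  refine iUnion hd (fun u => of_label (fun _ => ()) (fun _ _ _ _ _ => rfl)
    fun x hx y hy _ => hD u u.2 x hx y hy) fun u v x hx y hy hxy => ?_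
  by_contra huv
  exact (hsep u u.2 v v.2 (fun h => huv (Subtype.ext h)) x hx y hy).not_gt hxy

/-- Transport along a map which preserves distances. -/
theorem image {Y : Type*} [MetricSpace Y] {A : Set Y} (hA : IsClustered A d D) {φ : Y → Z}
    (hφ : Isometry φ) : IsClustered (φ '' A) d D := by
  obtain ⟨r, h₁, h₂⟩ := hA
  rcases isEmpty_or_nonempty Y with hY | hY
  · rw [Subsingleton.elim A ∅, image_empty]
    exact empty
  refine of_label (fun z => Quotient.mk r (Function.invFun φ z)) ?_ ?_
  · rintro _ ⟨x, hx, rfl⟩ _ ⟨y, hy, rfl⟩ hxy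
    rw [hφ.dist_eq] at hxy
    simp only [Function.leftInverse_invFun hφ.injective _]
    exact Quotient.sound (h₁ x hx y hy hxy)
  · rintro _ ⟨x, hx, rfl⟩ _ ⟨y, hy, rfl⟩ hxy
    simp only [Function.leftInverse_invFun hφ.injective _] at hxy
    rw [hφ.dist_eq]
    exact h₂ x hx y hy (Quotient.exact hxy)

end IsClustered

theorem AsdimLE.exists_isClustered {Z : Type*} [MetricSpace Z] {n : ℕ} (h : AsdimLE Z n) {d : ℝ}
    (hd : 0 < d) : ∃ D : ℝ, ∃ A : Fin (n + 1) → Set Z, (∀ i, IsClustered (A i) d D) ∧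
      ∀ x, ∃ i, x ∈ A i := by
  obtain ⟨U, ⟨D, hD⟩, hsep, hcov⟩ := h d hd
  exact ⟨D, fun i => ⋃₀ U i, fun i => IsClustered.sUnion hd (hD i) (hsep i), hcov⟩

theorem asdimLE_of_isClustered {Z : Type*} [MetricSpace Z] {n : ℕ}
    (h : ∀ d : ℝ, 0 < d → ∃ D : ℝ, ∃ A : Fin (n + 1) → Set Z, (∀ i, IsClustered (A i) d D) ∧
      ∀ x, ∃ i, x ∈ A i) : AsdimLE Z n := by
  intro d hd
  obtain ⟨D, A, hA, hcov⟩ := h d hd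
  choose r h₁ h₂ using hA
  refine ⟨fun i => range fun x => {y ∈ A i | r i x y}, ⟨D, ?_⟩, ?_, fun x => ?_⟩
  · rintro i _ ⟨z, rfl⟩ x ⟨hx, hzx⟩ y ⟨hy, hzy⟩
    exact h₂ i x hx y hy ((r i).trans ((r i).symm hzx) hzy)
  · rintro i _ ⟨z, rfl⟩ _ ⟨w, rfl⟩ hne x ⟨hx, hzx⟩ y ⟨hy, hwy⟩
    by_contra! hxy
    have hzw : r i z w := (r i).trans hzx ((r i).trans (h₁ i x hx y hy hxy) ((r i).symm hwy))
    refine hne (ext fun v => and_congr_right fun _ => ?_)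
    exact ⟨(r i).trans ((r i).symm hzw), (r i).trans hzw⟩
  · obtain ⟨i, hi⟩ := hcov x
    exact ⟨i, _, ⟨x, rfl⟩, hi, (r i).refl x⟩

/-! ### Maps to trees -/

/-- A Hurewicz type theorem: if `Z` has a Lipschitz map to a tree such that the preimages of balls
have asymptotic dimension at most `k` uniformly in the centre of the ball, then `asdim Z ≤ k + 1`. -/
theorem asdimLE_succ_of_map_to_tree {Z X : Type*} [MetricSpace Z] [MetricSpace X]
    (hX : IsMetricTree X) (o : X) (f : Z → X) {K : ℝ} (hK : 0 < K)
    (hf : ∀ z w, dist (f z) (f w) ≤ K * dist z w) (k : ℕ)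
    (hfib : ∀ R d : ℝ, 0 < R → 0 < d → ∃ D : ℝ, ∀ z, ∃ A : Fin (k + 1) → Set Z,
      (∀ i, IsClustered (A i) d D) ∧ ∀ w, dist (f w) (f z) ≤ R → ∃ i, w ∈ A i) :
    AsdimLE Z (k + 1) := by
  classical
  refine asdimLE_of_isClustered fun d hd => ?_
  obtain ⟨anc, hanc⟩ := hX.exists_ancestor o
  set δ := K * d
  have hδ0 : 0 < δ := mul_pos hK hd
  set h : Z → ℝ := fun z => dist o (f z)
  have hfd : ∀ z w, dist z w < d → dist (f z) (f w) < δ := fun z w hzw =>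
    (hf z w).trans_lt (mul_lt_mul_of_pos_left hzw hK)
  have hhd : ∀ z w, dist z w < d → h z < h w + δ := fun z w hzw => by
    have := dist_triangle_right o (f z) (f w)
    linarith [hfd z w hzw]
  -- The height of a block; half a block has room for `k + 1` collars of width `δ`, `δ` apart.
  set L : ℝ := 4 * (k + 2) * δ with hL
  have hkδ : 0 ≤ k * δ := by positivity
  have hL0 : 0 < L := by positivity
  have hLδ : 8 * δ ≤ L := by rw [hL]; linarith
  set t : Fin (k + 1) → ℝ := fun i => 2 * (i : ℕ) * δ with ht
  have ht0 : ∀ i, 0 ≤ t i := fun i => by positivity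
  have htL : ∀ i, t i + δ ≤ L / 2 := fun i => by
    have : ((i : ℕ) : ℝ) ≤ k := by exact_mod_cast Nat.lt_succ_iff.1 i.2
    have := mul_le_mul_of_nonneg_right this hδ0.le
    simp only [ht, hL]
    linarith
  -- The block of a point, for the division of the tree into blocks shifted by `s`.
  set blk : ℝ → Z → ℤ := fun s z => ⌊(h z - s) / L⌋ with hblk
  have hblk_iff : ∀ s z (n : ℤ), blk s z = n ↔ n * L + s ≤ h z ∧ h z < n * L + s + L := by
    intro s z n
    rw [hblk, Int.floor_eq_iff, le_div_iff₀ hL0, div_lt_iff₀ hL0]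
    constructor <;> rintro ⟨h1, h2⟩ <;> constructor <;> linarith
  have hblk_mem : ∀ s z, blk s z * L + s ≤ h z ∧ h z < blk s z * L + s + L :=
    fun s z => (hblk_iff s z _).1 rfl
  have hmulL : ∀ m n : ℤ, m < n → (m : ℝ) * L + L ≤ n * L := fun m n hmn => by
    have : (m : ℝ) + 1 ≤ n := by exact_mod_cast hmn
    linarith [mul_le_mul_of_nonneg_right this hL0.le]
  -- The cell of a point: its block and its ancestor one block below.
  set cell : ℝ → Z → ℤ × X := fun s z => (blk s z, anc ((blk s z - 1) * L) (f z)) with hcell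
  have hcell_eq : ∀ s, 0 ≤ s → ∀ z w, dist z w < d → blk s z = blk s w → cell s z = cell s w := by
    intro s hs z w hzw hb
    by_contra hne
    have hz := hblk_mem s z
    have hw := hblk_mem s w
    have hne' : anc ((blk s z - 1) * L) (f z) ≠ anc ((blk s z - 1) * L) (f w) := by
      intro heq
      exact hne (by simp only [hcell]; rw [← hb, heq])
    rw [← hb] at hw
    have := (hanc ((blk s z - 1) * L) (f z) (f w)
      (by change _ ≤ h z; linarith) (by change _ ≤ h w; linarith)).2 hne'
    change h z + h w - _ ≤ _ at this
    linarith [hfd z w hzw]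
  have hcell_dist : ∀ z w, cell 0 z = cell 0 w → dist (f z) (f w) ≤ 4 * L := by
    intro z w hzw
    have hb : blk 0 z = blk 0 w := congrArg Prod.fst hzw
    have ha : anc ((blk 0 z - 1) * L) (f z) = anc ((blk 0 w - 1) * L) (f w) :=
      congrArg Prod.snd hzw
    have hz := hblk_mem 0 z
    have hw := hblk_mem 0 w
    rw [← hb] at ha hw
    have := (hanc ((blk 0 z - 1) * L) (f z) (f w)
      (by change _ ≤ h z; linarith) (by change _ ≤ h w; linarith)).1 ha
    change _ ≤ h z + h w - _ at this
    linarith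
  -- At every scale, the unshifted cells are covered by `k + 1` uniformly clustered sets.
  have hcov : ∀ e : ℝ, 0 < e → ∃ R : ℝ, 0 ≤ R ∧ ∃ A : ℤ × X → Fin (k + 1) → Set Z,
      (∀ j i, IsClustered (A j i) e R) ∧ ∀ z, ∃ i, z ∈ A (cell 0 z) i := by
    intro e he
    obtain ⟨R, hR⟩ := hfib (4 * L) e (by positivity) he
    have : ∀ j : ℤ × X, ∃ A : Fin (k + 1) → Set Z,
        (∀ i, IsClustered (A i) e (max R 0)) ∧ ∀ z, cell 0 z = j → ∃ i, z ∈ A i := by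
      intro j
      by_cases hj : ∃ w, cell 0 w = j
      · obtain ⟨w, rfl⟩ := hj
        obtain ⟨A, hA, hcov⟩ := hR w
        exact ⟨A, fun i => (hA i).mono_right (le_max_left _ _),
          fun z hz => hcov z (hcell_dist z w hz)⟩
      · exact ⟨fun _ => ∅, fun _ => IsClustered.empty, fun z hz => absurd ⟨z, hz⟩ hj⟩
    choose A hA hcov using this
    exact ⟨max R 0, le_max_right _ _, A, hA, fun z => hcov _ z rfl⟩
  obtain ⟨R, hR0, A, hA, hAcov⟩ := hcov d hd
  obtain ⟨D, hD0, B, hB, hBcov⟩ := hcov (2 * R + 3 * d) (by positivity)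
  -- In the lower halves of the blocks the `A`-clusters of all cells can be used together.
  set low : Set Z := {z | h z < blk 0 z * L + L / 2} with hlow
  have hlow_blk : ∀ z ∈ low, ∀ w ∈ low, dist z w < d → blk 0 z = blk 0 w := by
    have hnlt : ∀ z ∈ low, ∀ w, dist z w < d → ¬ blk 0 z < blk 0 w := by
      intro z hz w hzw hlt
      have h1 := hblk_mem 0 w
      have h2 := hhd w z (by rwa [dist_comm])
      have h3 : h z < blk 0 z * L + L / 2 := hz
      linarith [hmulL _ _ hlt]
    intro z hz w hw hzw
    have := hnlt z hz w hzw
    have := hnlt w hw z (by rwa [dist_comm])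
    omega
  set Alow : Fin (k + 1) → Set Z := fun i => {z ∈ low | z ∈ A (cell 0 z) i} with hAlow
  have hAlow_cl : ∀ i, IsClustered (Alow i) d R := by
    intro i
    refine (IsClustered.iUnion (A := fun j => {z ∈ Alow i | cell 0 z = j}) hd
      (fun j => (hA j i).mono ?_) ?_).mono fun z hz => mem_iUnion.2 ⟨_, hz, rfl⟩
    · rintro z ⟨hz, rfl⟩
      exact hz.2
    · rintro _ _ z ⟨hz, rfl⟩ w ⟨hw, rfl⟩ hzw
      exact hcell_eq 0 le_rfl z w hzw (hlow_blk z hz.1 w hw.1 hzw)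
  -- The collars at which the colours are cut.
  set collar : Fin (k + 1) → Set Z := fun i =>
    {z | blk 0 z * L + t i ≤ h z ∧ h z < blk 0 z * L + t i + δ} with hcollar
  set Bup : Fin (k + 1) → Set Z := fun i => {z | z ∉ low ∧ z ∈ B (cell 0 z) i} with hBup
  have hup : ∀ i, ∀ z ∉ low, blk (t i) z = blk 0 z := by
    intro i z hz
    have h1 := hblk_mem 0 z
    have h2 : blk 0 z * L + L / 2 ≤ h z := not_lt.1 hz
    rw [hblk_iff]
    constructor <;> linarith [ht0 i, htL i]
  -- Outside the collar of colour `i`, the blocks shifted by `t i` are separated.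
  have habove : ∀ i, ∀ z ∈ Alow i \ collar i ∪ Bup i, blk (t i) z * L + t i + δ ≤ h z := by
    rintro i z (⟨⟨hz, -⟩, hzc⟩ | ⟨hz, -⟩)
    · have h1 := hblk_mem 0 z
      have h2 : h z < blk 0 z * L + L / 2 := hz
      rcases lt_or_ge (h z) (blk 0 z * L + t i) with h3 | h3
      · have : blk (t i) z = blk 0 z - 1 := by
          rw [hblk_iff]
          push_cast
          constructor <;> linarith [htL i]
        rw [this]
        push_cast
        linarith [htL i]
      · have h4 : blk 0 z * L + t i + δ ≤ h z := not_lt.1 fun h4 => hzc ⟨h3, h4⟩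
        have : blk (t i) z = blk 0 z := by
          rw [hblk_iff]
          constructor <;> linarith [ht0 i]
        rwa [this]
    · rw [hup i z hz]
      have h2 : blk 0 z * L + L / 2 ≤ h z := not_lt.1 hz
      linarith [htL i]
  have hcut : ∀ i, ∀ z ∈ Alow i \ collar i ∪ Bup i, ∀ w ∈ Alow i \ collar i ∪ Bup i,
      dist z w < d → blk (t i) z = blk (t i) w := by
    intro i
    have hnlt : ∀ z, ∀ w ∈ Alow i \ collar i ∪ Bup i, dist z w < d →
        ¬ blk (t i) z < blk (t i) w := by
      intro z w hw hzw hlt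
      have h1 := hblk_mem (t i) z
      have h2 := habove i w hw
      have h3 := hhd w z (by rwa [dist_comm])
      linarith [hmulL _ _ hlt]
    intro z hz w hw hzw
    have := hnlt z w hw hzw
    have := hnlt w z hz (by rwa [dist_comm])
    omega
  have hcol : ∀ i, IsClustered (Alow i \ collar i ∪ Bup i) d (D + 2 * (R + d)) := by
    intro i
    refine (IsClustered.iUnion
      (A := fun j => {z ∈ Alow i \ collar i ∪ Bup i | cell (t i) z = j}) hd (fun j => ?_) ?_).mono
        fun z hz => mem_iUnion.2 ⟨_, hz, rfl⟩
    · refine (((hAlow_cl i).union (hB j i) hd hR0 hD0)).mono ?_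
      rintro z ⟨⟨hz, -⟩ | ⟨hz, hzB⟩, rfl⟩
      · exact Or.inl hz
      · refine Or.inr ?_
        have : cell (t i) z = cell 0 z := by simp only [hcell, hup i z hz]
        rwa [this]
    · rintro _ _ z ⟨hz, rfl⟩ w ⟨hw, rfl⟩ hzw
      exact hcell_eq (t i) (ht0 i) z w hzw (hcut i z hz w hw hzw)
  have hcollar_eq : ∀ i j, ∀ z ∈ collar i, ∀ w ∈ collar j, dist z w < d →
      blk 0 z = blk 0 w → i = j := by
    have key : ∀ i j, ∀ z ∈ collar i, ∀ w ∈ collar j, dist z w < d →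
        blk 0 z = blk 0 w → ¬ i < j := by
      rintro i j z ⟨-, hz⟩ w ⟨hw, -⟩ hzw hb hij
      rw [hb] at hz
      have h1 := hhd w z (by rwa [dist_comm])
      have h2 : ((i : ℕ) : ℝ) + 1 ≤ (j : ℕ) := by exact_mod_cast hij
      have h3 := mul_le_mul_of_nonneg_right h2 hδ0.le
      simp only [ht] at hz hw
      linarith
    intro i j z hz w hw hzw hb
    exact le_antisymm (not_lt.1 (key j i w hw z hz (by rwa [dist_comm]) hb.symm))
      (not_lt.1 (key i j z hz w hw hzw hb))
  -- The additional colour takes what the other colours lose in their collars.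
  have hlast : IsClustered (⋃ i, Alow i ∩ collar i) d R :=
    IsClustered.iUnion hd (fun i => (hAlow_cl i).mono inter_subset_left)
      fun i j z hz w hw hzw =>
        hcollar_eq i j z hz.2 w hw.2 hzw (hlow_blk z hz.1.1 w hw.1.1 hzw)
  refine ⟨D + 2 * (R + d), Fin.snoc (α := fun _ => Set Z) (fun i => Alow i \ collar i ∪ Bup i)
    (⋃ i, Alow i ∩ collar i), ?_, fun z => ?_⟩
  · intro i
    refine Fin.lastCases ?_ (fun i => ?_) i
    · rw [Fin.snoc_last]
      exact hlast.mono_right (by linarith)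
    · rw [Fin.snoc_castSucc]
      exact hcol i
  · by_cases hz : z ∈ low
    · obtain ⟨i, hi⟩ := hAcov z
      by_cases hc : z ∈ collar i
      · refine ⟨Fin.last _, ?_⟩
        rw [Fin.snoc_last]
        exact mem_iUnion.2 ⟨i, ⟨hz, hi⟩, hc⟩
      · refine ⟨i.castSucc, ?_⟩
        rw [Fin.snoc_castSucc]
        exact Or.inl ⟨⟨hz, hi⟩, hc⟩
    · obtain ⟨i, hi⟩ := hBcov z
      refine ⟨i.castSucc, ?_⟩
      rw [Fin.snoc_castSucc]
      exact Or.inr ⟨hz, hi⟩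

/-! ### Word metrics -/

theorem IsFiniteGeneratingSet.exists_wordNorm_le {Γ : Type*} [Group Γ] {S T : Set Γ}
    (hS : IsFiniteGeneratingSet S) (hT : IsFiniteGeneratingSet T) :
    ∃ C : ℕ, 0 < C ∧ ∀ g, wordNorm S g ≤ C * wordNorm T g := by
  obtain ⟨M, hM⟩ := (hT.finite.image (wordNorm S)).bddAbove
  have hlist : ∀ l : List Γ, (∀ s ∈ l, s ∈ T) → wordNorm S l.prod ≤ (M + 1) * l.length := by
    intro l hl
    induction l with
    | nil => simpa using wordNorm_prod_le (S := S) [] (by simp)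
    | cons a l ih =>
      have h₁ := ih fun s hs => hl s (List.mem_cons_of_mem _ hs)
      have h₂ := hM (mem_image_of_mem (wordNorm S) (hl a List.mem_cons_self))
      rw [List.prod_cons, List.length_cons]
      linarith [hS.wordNorm_mul_le a l.prod]
  refine ⟨M + 1, M.succ_pos, fun g => ?_⟩
  obtain ⟨l, hl, rfl, hn⟩ := hT.exists_word g
  rw [← hn]
  exact hlist l hl

/-- The orbit map of an isometric action is Lipschitz for the word metric. -/
theorem IsFiniteGeneratingSet.exists_dist_smul_le {Γ : Type*} [Group Γ] {S : Set Γ}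
    (hS : IsFiniteGeneratingSet S) {X : Type*} [MetricSpace X] [MulAction Γ X]
    [IsIsometricSMul Γ X] (x₀ : X) :
    ∃ K : ℝ, 0 < K ∧ ∀ g h : Γ, dist (g • x₀) (h • x₀) ≤ K * (wordNorm S (g⁻¹ * h) : ℝ) := by
  obtain ⟨M, hM⟩ := (hS.finite.image fun s => dist x₀ (s • x₀)).bddAbove
  have hlist : ∀ l : List Γ, (∀ s ∈ l, s ∈ S) →
      dist x₀ (l.prod • x₀) ≤ max M 1 * (l.length : ℝ) := by
    intro l hl
    induction l with
    | nil => simp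
    | cons a l ih =>
      have h₁ := ih fun s hs => hl s (List.mem_cons_of_mem _ hs)
      have h₂ : dist x₀ (a • x₀) ≤ M :=
        hM (mem_image_of_mem (fun s => dist x₀ (s • x₀)) (hl a List.mem_cons_self))
      have h₃ := dist_triangle x₀ (a • x₀) (a • l.prod • x₀)
      rw [dist_smul] at h₃
      rw [List.prod_cons, List.length_cons, mul_smul]
      push_cast
      linarith [le_max_left M 1]
  refine ⟨max M 1, by positivity, fun g h => ?_⟩
  obtain ⟨l, hl, hp, hn⟩ := hS.exists_word (g⁻¹ * h)
  have := hlist l hl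
  rw [hp, hn, ← dist_smul g, ← mul_smul, mul_inv_cancel_left] at this
  exact this

/-- Asymptotic dimension does not depend on the finite generating set. -/
theorem asdimLE_wordMetric_of_asdimLE_wordMetric {Γ : Type*} [Group Γ] {S T : Set Γ}
    (hS : IsFiniteGeneratingSet S) (hT : IsFiniteGeneratingSet T) {n : ℕ}
    (h : letI := wordMetric S hS; AsdimLE Γ n) : letI := wordMetric T hT; AsdimLE Γ n := by
  intro d hd
  obtain ⟨C, hC, hSC⟩ := hS.exists_wordNorm_le hT
  obtain ⟨C', hC', hTC⟩ := hT.exists_wordNorm_le hS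
  have hC0 : (0 : ℝ) < C := by exact_mod_cast hC
  obtain ⟨U, ⟨D, hD⟩, hsep, hcov⟩ := h (C * d) (mul_pos hC0 hd)
  refine ⟨U, ⟨C' * D, fun i u hu x hx y hy => ?_⟩, fun i u hu v hv huv x hx y hy => ?_, hcov⟩
  · have h₁ : (wordNorm S (x⁻¹ * y) : ℝ) ≤ D := hD i u hu x hx y hy
    have h₂ : (wordNorm T (x⁻¹ * y) : ℝ) ≤ C' * wordNorm S (x⁻¹ * y) := by
      exact_mod_cast hTC (x⁻¹ * y)
    exact h₂.trans (mul_le_mul_of_nonneg_left h₁ (Nat.cast_nonneg _))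
  · have h₁ : C * d ≤ (wordNorm S (x⁻¹ * y) : ℝ) := hsep i u hu v hv huv x hx y hy
    have h₂ : (wordNorm S (x⁻¹ * y) : ℝ) ≤ C * wordNorm T (x⁻¹ * y) := by
      exact_mod_cast hSC (x⁻¹ * y)
    exact le_of_mul_le_mul_left (h₁.trans h₂) hC0

theorem lemma2 {Γ : Type*} [Group Γ] (S : Set Γ) (hS : IsFiniteGeneratingSet S)
    {X : Type*} [MetricSpace X] (hX : IsMetricTree X) [MulAction Γ X] [IsIsometricSMul Γ X]
    (x₀ : X) (k : ℕ)
    (hW : ∀ R : ℝ, 0 < R → letI := wordMetric S hS; AsdimLE (rStabilizer Γ x₀ R) k) :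
    ∀ (T : Set Γ) (hT : IsFiniteGeneratingSet T),
      letI := wordMetric T hT; AsdimLE Γ (k + 1) := by
  intro T hT
  refine asdimLE_wordMetric_of_asdimLE_wordMetric hS hT ?_
  let _ := wordMetric S hS
  obtain ⟨K, hK, hlip⟩ := hS.exists_dist_smul_le (X := X) x₀
  refine asdimLE_succ_of_map_to_tree hX x₀ (fun g : Γ => g • x₀) hK hlip k fun R d hR hd => ?_
  obtain ⟨D, A, hA, hcov⟩ := (hW R hR).exists_isClustered hd
  -- the preimage of the ball of radius `R` around `g • x₀` is the translate `g W_R(x₀)`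
  refine ⟨D, fun g => ⟨fun i => (fun w : rStabilizer Γ x₀ R => g * w) '' A i, fun i => ?_, ?_⟩⟩
  · refine (hA i).image (Isometry.of_dist_eq fun v w => ?_)
    change (wordNorm S ((g * v)⁻¹ * (g * w)) : ℝ) = (wordNorm S ((v : Γ)⁻¹ * w) : ℝ)
    rw [mul_inv_rev, mul_assoc, inv_mul_cancel_left]
  · intro w hw
    have hmem : g⁻¹ * w ∈ rStabilizer Γ x₀ R := by
      change dist ((g⁻¹ * w) • x₀) x₀ ≤ R
      rwa [← dist_smul g, ← mul_smul, mul_inv_cancel_left]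
    obtain ⟨i, hi⟩ := hcov ⟨g⁻¹ * w, hmem⟩
    exact ⟨i, _, hi, mul_inv_cancel_left g w⟩
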